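/- For a well-founded poset $P$, let $\mathrm{rk}_P(x)=\sup_{x'<x}(\mathrm{rk}_P(x')+1)$ for $x\in P$ (with $\sup\emptyset=0$) and let $|P|=\sup_{x\in P}(\mathrm{rk}_P(x)+1)$ be the ordinal rank of $P$. A topological space $X$ is Noetherian if the poset $\mathcal H_0X$ of all closed subsets of $X$ (including $\emptyset$ and $X$), ordered by inclusion, is well-founded; its stature is then the ordinal $\|X\|=|\mathcal H_0X|-1$, where $\alpha-1$ denotes the predecessor of a successor ordinal $\alpha$ (the rank $|\mathcal H_0X|$ is a successor because $\mathcal H_0X$ has the largest element $X$). For ordinals written in Cantor normal form $\alpha=\omega^{\alpha_1}+\cdots+\omega^{\alpha_m}$ with $\alpha_1\ge\cdots\ge\alpha_m$, and $\beta=\omega^{\beta_1}+\cdots+\omega^{\beta_n}$ with $\beta_1\ge\cdots\ge\beta_n$ ($m,n\ge 0$), the natural (Hessenberg) sum is $\alpha\oplus\beta=\omega^{\gamma_1}+\cdots+\omega^{\gamma_{m+n}}$, where $\gamma_1\ge\cdots\ge\gamma_{m+n}$ is the list $\alpha_1,\dots,\alpha_m,\beta_1,\dots,\beta_n$ sorted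 in decreasing order, and the natural (Hessenberg) product is $\alpha\otimes\beta=\bigoplus_{1\le i\le m,\ 1\le j\le n}\omega^{\alpha_i\oplus\beta_j}$. **Theorem.** For all Noetherian spaces $X$ and $Y$, the product space $X\times Y$ (which is again Noetherian) satisfies $$\|X\times Y\|=\|X\|\otimes\|Y\|.$$ -/

import Mathlib

universe u v

namespace NoetherianStature

/-! ### Natural (Hessenberg) operations on ordinals -/

/-- The natural-number coefficients in the Cantor normal form
`a = ω ^ e₁ * n₁ + ⋯ + ω ^ eₖ * nₖ` (`e₁ > ⋯ > eₖ`): the value at `e` is the number of terms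
`ω ^ e` in the normal form of `a` when it is written without coefficients. -/
noncomputable def cnfCoeff (a : Ordinal.{u}) : Ordinal.{u} →₀ ℕ :=
  (Ordinal.CNF.coeff Ordinal.omega0 a).mapRange
    (fun c : Ordinal.{u} => Cardinal.toNat c.card) (by simp)

/-- The ordinal with given Cantor normal form coefficients: the ordinal sum of the terms
`ω ^ e * f e`, taken in decreasing order of the exponents `e`. -/
noncomputable def ofCnfCoeff (f : Ordinal.{u} →₀ ℕ) : Ordinal.{u} :=
  Ordinal.CNF.eval Ordinal.omega0
    (f.mapRange (fun n : ℕ => (n : Ordinal.{u})) Nat.cast_zero)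

/-- The natural (Hessenberg) sum: merge the terms of the two Cantor normal forms and add them up
in decreasing order. -/
noncomputable def natSum (a b : Ordinal.{u}) : Ordinal.{u} :=
  ofCnfCoeff (cnfCoeff a + cnfCoeff b)

/-- The natural (Hessenberg) product: the natural sum of the terms `ω ^ (natSum e e')`, for all
pairs of a term `ω ^ e` of `a` and a term `ω ^ e'` of `b`, counted with multiplicity. -/
noncomputable def natProd (a b : Ordinal.{u}) : Ordinal.{u} :=
  ofCnfCoeff ((cnfCoeff a).sum fun e m =>
    (cnfCoeff b).sum fun e' n => Finsupp.single (natSum e e') (m * n))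

/-! ### Ordinal rank and stature -/

/-- The ordinal rank `|P|` of a well-founded poset `P`: the supremum of `rk x + 1` for `x` in `P`,
where `rk x` is the supremum of `rk y + 1` for `y < x`. -/
noncomputable def ordinalRank (P : Type u) [PartialOrder P] [WellFoundedLT P] : Ordinal.{u} :=
  ⨆ x : P, Order.succ (IsWellFounded.rank (fun y z : P => y < z) x)

/-- The stature of a Noetherian space `X`: the rank, minus one, of the poset of all closed subsets
of `X` (including the empty set and `X`), ordered by inclusion. -/
noncomputable def stature (X : Type u) [TopologicalSpace X]
    [TopologicalSpace.NoetherianSpace X] : Ordinal.{u} :=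
  Ordinal.pred (ordinalRank (TopologicalSpace.Closeds X))

/-! ### Products of Noetherian spaces are Noetherian -/

/-- An ultrafilter on a Noetherian space contains the set of its limits. -/
theorem limits_mem_ultrafilter {X : Type u} [TopologicalSpace X]
    [TopologicalSpace.NoetherianSpace X] (F : Ultrafilter X) :
    {x : X | (F : Filter X) ≤ nhds x} ∈ F := by
  obtain ⟨C, hC, hmin⟩ := (wellFounded_lt (α := TopologicalSpace.Closeds X)).has_min
    {C | (C : Set X) ∈ F} ⟨⊤, Filter.univ_mem⟩
  refine Filter.mem_of_superset hC fun x hx => ?_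
  refine le_nhds_iff.2 fun U hxU hU => ?_
  by_contra hUF
  have hc : Uᶜ ∈ F := Ultrafilter.compl_mem_iff_notMem.2 hUF
  let D : TopologicalSpace.Closeds X := ⟨Uᶜ, hU.isClosed_compl⟩
  have hCD : ((C ⊓ D : TopologicalSpace.Closeds X) : Set X) ∈ F := by
    rw [TopologicalSpace.Closeds.coe_inf]
    exact Filter.inter_mem hC hc
  refine hmin (C ⊓ D) hCD (lt_of_le_of_ne inf_le_left fun h => ?_)
  have hxD : x ∈ (D : Set X) := (inf_eq_left.1 h) hx
  exact hxD hxU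

instance instNoetherianSpaceProd {X : Type u} {Y : Type v} [TopologicalSpace X]
    [TopologicalSpace.NoetherianSpace X] [TopologicalSpace Y]
    [TopologicalSpace.NoetherianSpace Y] : TopologicalSpace.NoetherianSpace (X × Y) := by
  refine TopologicalSpace.noetherianSpace_iff_isCompact.2 fun s =>
    isCompact_iff_ultrafilter_le_nhds.2 fun F hF => ?_
  have h1 : Prod.fst ⁻¹' {x : X | (F.map Prod.fst : Filter X) ≤ nhds x} ∈ F :=
    limits_mem_ultrafilter (F.map Prod.fst)
  have h2 : Prod.snd ⁻¹' {y : Y | (F.map Prod.snd : Filter Y) ≤ nhds y} ∈ F :=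
    limits_mem_ultrafilter (F.map Prod.snd)
  have hs : s ∈ F := Filter.le_principal_iff.1 hF
  obtain ⟨p, hp, hp1, hp2⟩ :=
    Ultrafilter.nonempty_of_mem (Filter.inter_mem hs (Filter.inter_mem h1 h2))
  refine ⟨p, hp, ?_⟩
  rw [nhds_prod_eq]
  exact Filter.le_prod.2 ⟨hp1, hp2⟩

end NoetherianStature

/-!
The rank of a closed set is analysed in the distributive lattice of closed sets, and compared with
the arithmetic of Cantor normal forms. The natural sum is coefficientwise addition, ordinals being
ordered by the coefficient of the largest exponent where they differ, and the natural product is a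
bilinear operation on coefficients.

*Upper bound* (`stature_prod_le_of_stature_le`). The rank is subadditive: if a space is covered by
two subspaces, its stature is at most the natural sum of theirs
(`rk_le_natSum_of_subset_range`). If the stature of `X` is not a power of `ω`, write it as
`a + ω ^ p`, where `ω ^ p` is the last term of its normal form, and take a closed set `C` of rank
`a`. Then `rk C + ‖X \ C‖ ≤ ‖X‖` gives `‖X \ C‖ ≤ ω ^ p`, and induction applies to `C × Y` and
`(X \ C) × Y`; likewise for `Y`. If `‖X‖ = ω ^ p` and `‖Y‖ = ω ^ q`, every proper closed subset of
`X × Y` lies in some `C × Y ∪ X × D` with `C` and `D` proper closed subsets; both pieces have rank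
below `ω ^ (p ⊕ q)`, which is closed under natural sums.

*Lower bound* (`le_rk_prod`). The rank is supermodular (`natSum_rk_le`). Applied to the rectangles
`C' × D` and `C × D'` with `C' < C` and `D' < D`, this bounds from below the rank of their union, a
proper subset of `C × D`; the rank of their intersection `C' × D'` is controlled by the upper bound.
The resulting inequality is Conway's recursion for the natural product
(`exists_natSum_natProd_le`).

The two spaces may live in different universes; `ULift` reduces this to a single universe.
-/

namespace NoetherianStature

/-! ### Cantor normal form coefficients -/

open Ordinal Finsupp in
theorem ofCnfCoeff_cnfCoeff (a : Ordinal.{u}) : ofCnfCoeff (cnfCoeff a) = a := by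
  have h : (cnfCoeff a).mapRange (fun n : ℕ => (n : Ordinal.{u})) Nat.cast_zero =
      CNF.coeff ω a := by
    ext e
    have hlt : CNF.coeff ω a e < ω := by
      by_cases he : e ∈ (CNF ω a).map Prod.fst
      · obtain ⟨⟨e, c⟩, hc, rfl⟩ := List.mem_map.1 he
        rw [CNF.coeff_of_mem_CNF hc]
        exact CNF.snd_lt one_lt_omega0 hc
      · rw [CNF.coeff_of_notMem_CNF he]
        exact omega0_pos
    obtain ⟨n, hn⟩ := lt_omega0.1 hlt
    simp [cnfCoeff, hn]
  rw [ofCnfCoeff, h, CNF.eval_coeff]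

open Ordinal in
theorem cnfCoeff_ofCnfCoeff (f : Ordinal.{u} →₀ ℕ) : cnfCoeff (ofCnfCoeff f) = f := by
  rw [cnfCoeff, ofCnfCoeff, CNF.coeff_eval one_lt_omega0 fun e => natCast_lt_omega0 (f e)]
  ext e
  simp

theorem cnfCoeff_injective : Function.Injective cnfCoeff.{u} :=
  Function.LeftInverse.injective ofCnfCoeff_cnfCoeff

@[simp]
theorem ofCnfCoeff_zero : ofCnfCoeff.{u} 0 = 0 := by
  simp [ofCnfCoeff]

@[simp]
theorem cnfCoeff_zero : cnfCoeff.{u} 0 = 0 := by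
  rw [← ofCnfCoeff_zero, cnfCoeff_ofCnfCoeff]

@[simp]
theorem ofCnfCoeff_single (e : Ordinal.{u}) (n : ℕ) :
    ofCnfCoeff (Finsupp.single e n) = Ordinal.omega0 ^ e * n := by
  simp [ofCnfCoeff]

theorem cnfCoeff_opow_mul (e : Ordinal.{u}) (n : ℕ) :
    cnfCoeff (Ordinal.omega0 ^ e * n) = Finsupp.single e n := by
  rw [← ofCnfCoeff_single, cnfCoeff_ofCnfCoeff]

@[simp]
theorem cnfCoeff_opow (e : Ordinal.{u}) :
    cnfCoeff (Ordinal.omega0 ^ e) = Finsupp.single e 1 := by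
  simpa using cnfCoeff_opow_mul e 1

/-- If no exponent of `g` exceeds an exponent of `f`, merging the two normal forms amounts to
concatenating them. -/
theorem ofCnfCoeff_add {f g : Ordinal.{u} →₀ ℕ}
    (h : ∀ e ∈ f.support, ∀ e' ∈ g.support, e' ≤ e) :
    ofCnfCoeff (f + g) = ofCnfCoeff f + ofCnfCoeff g := by
  rw [ofCnfCoeff, Finsupp.mapRange_add (by simp), Ordinal.CNF.eval_add]
  · rfl
  · intro e he e' he'
    exact h e (Finsupp.support_mapRange he) e' (Finsupp.support_mapRange he')

theorem ofCnfCoeff_lt_opow {f : Ordinal.{u} →₀ ℕ} {e : Ordinal.{u}}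
    (h : ∀ e' ∈ f.support, e' < e) : ofCnfCoeff f < Ordinal.omega0 ^ e :=
  Ordinal.CNF.eval_lt (fun e' => by simp)
    fun e' he' => h e' (Finsupp.support_mapRange he')

theorem ofCnfCoeff_eq_filter_add (f : Ordinal.{u} →₀ ℕ) (e : Ordinal.{u}) :
    ofCnfCoeff f = ofCnfCoeff (f.filter (e < ·)) +
      (Ordinal.omega0 ^ e * f e + ofCnfCoeff (f.filter (· < e))) := by
  have h : f = f.filter (e < ·) + (Finsupp.single e (f e) + f.filter (· < e)) := by
    ext i
    rcases lt_trichotomy i e with hi | rfl | hi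
    · simp [hi, hi.not_gt, hi.ne]
    · simp
    · simp [hi, hi.not_gt, hi.ne']
  conv_lhs => rw [h]
  rw [ofCnfCoeff_add, ofCnfCoeff_add, ofCnfCoeff_single]
  · intro i hi j hj
    rw [Finsupp.support_filter, Finset.mem_filter] at hj
    rw [Finset.mem_singleton.1 (Finsupp.support_single_subset hi)]
    exact hj.2.le
  · intro i hi j hj
    rw [Finsupp.support_filter, Finset.mem_filter] at hi
    refine le_trans ?_ hi.2.le
    rcases Finset.mem_union.1 (Finsupp.support_add hj) with hj | hj
    · rw [Finset.mem_singleton.1 (Finsupp.support_single_subset hj)]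
    · rw [Finsupp.support_filter, Finset.mem_filter] at hj
      exact hj.2.le

/-- Ordinals are compared through the coefficient of the largest exponent at which their Cantor
normal forms differ. -/
theorem ofCnfCoeff_strictMono :
    StrictMono fun f : Colex (Ordinal.{u} →₀ ℕ) => ofCnfCoeff (ofColex f) := by
  intro f g hfg
  obtain ⟨i, hi, hlt⟩ := Finsupp.Colex.lt_iff.1 hfg
  change ofCnfCoeff (ofColex f) < ofCnfCoeff (ofColex g)
  have heq : (ofColex f).filter (i < ·) = (ofColex g).filter (i < ·) := by
    ext j
    simp only [Finsupp.filter_apply]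
    split_ifs with hj
    · exact hi j hj
    · rfl
  rw [ofCnfCoeff_eq_filter_add (ofColex f) i, ofCnfCoeff_eq_filter_add (ofColex g) i, heq]
  refine (add_lt_add_iff_left _).2 (lt_of_lt_of_le ?_ le_self_add)
  refine Ordinal.opow_mul_add_lt_opow_mul (ofCnfCoeff_lt_opow fun e' he' => ?_)
    (Nat.cast_lt.2 hlt)
  rw [Finsupp.support_filter, Finset.mem_filter] at he'
  exact he'.2

theorem toColex_cnfCoeff_lt_iff {a b : Ordinal.{u}} :
    toColex (cnfCoeff a) < toColex (cnfCoeff b) ↔ a < b := by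
  rw [← ofCnfCoeff_strictMono.lt_iff_lt]
  simp [ofCnfCoeff_cnfCoeff]

theorem toColex_cnfCoeff_le_iff {a b : Ordinal.{u}} :
    toColex (cnfCoeff a) ≤ toColex (cnfCoeff b) ↔ a ≤ b := by
  rw [← ofCnfCoeff_strictMono.le_iff_le]
  simp [ofCnfCoeff_cnfCoeff]

/-- A nonzero ordinal ends with a term `ω ^ e` of its Cantor normal form, where `e` is at most every
exponent of the remaining part. -/
theorem exists_cnfCoeff_eq_add_single {a : Ordinal.{u}} (ha : a ≠ 0) :
    ∃ b e : Ordinal.{u}, cnfCoeff a = cnfCoeff b + Finsupp.single e 1 ∧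
      ∀ e' ∈ (cnfCoeff a).support, e ≤ e' := by
  have hs : (cnfCoeff a).support.Nonempty := by
    rw [Finsupp.support_nonempty_iff]
    exact fun h => ha (cnfCoeff_injective (h.trans cnfCoeff_zero.symm))
  refine ⟨ofCnfCoeff (cnfCoeff a - Finsupp.single ((cnfCoeff a).support.min' hs) 1),
    (cnfCoeff a).support.min' hs, ?_, fun e' he' => Finset.min'_le _ _ he'⟩
  rw [cnfCoeff_ofCnfCoeff, tsub_add_cancel_of_le]
  rw [Finsupp.single_le_iff, Nat.one_le_iff_ne_zero, ← Finsupp.mem_support_iff]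
  exact Finset.min'_mem _ hs

/-! ### The natural sum -/

@[simp]
theorem cnfCoeff_natSum (a b : Ordinal.{u}) :
    cnfCoeff (natSum a b) = cnfCoeff a + cnfCoeff b :=
  cnfCoeff_ofCnfCoeff _

theorem natSum_comm (a b : Ordinal.{u}) : natSum a b = natSum b a :=
  cnfCoeff_injective (by simp [add_comm])

@[simp]
theorem natSum_zero (a : Ordinal.{u}) : natSum a 0 = a :=
  cnfCoeff_injective (by simp)

@[simp]
theorem zero_natSum (a : Ordinal.{u}) : natSum 0 a = a := by
  rw [natSum_comm, natSum_zero]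

theorem natSum_assoc (a b c : Ordinal.{u}) :
    natSum (natSum a b) c = natSum a (natSum b c) :=
  cnfCoeff_injective (by simp [add_assoc])

theorem natSum_lt_natSum_left {a b : Ordinal.{u}} (h : a < b) (c : Ordinal.{u}) :
    natSum c a < natSum c b := by
  rw [← toColex_cnfCoeff_lt_iff] at h ⊢
  simpa using add_lt_add_right h (toColex (cnfCoeff c))

theorem natSum_lt_natSum_right {a b : Ordinal.{u}} (h : a < b) (c : Ordinal.{u}) :
    natSum a c < natSum b c := by
  rw [natSum_comm a, natSum_comm b]
  exact natSum_lt_natSum_left h c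

theorem natSum_le_natSum {a b c d : Ordinal.{u}} (h₁ : a ≤ b) (h₂ : c ≤ d) :
    natSum a c ≤ natSum b d :=
  ((StrictMono.monotone fun _ _ h => natSum_lt_natSum_right h c) h₁).trans
    ((StrictMono.monotone fun _ _ h => natSum_lt_natSum_left h b) h₂)

theorem natSum_lt_natSum_of_le_of_lt {a b c d : Ordinal.{u}} (h₁ : a ≤ b) (h₂ : c < d) :
    natSum a c < natSum b d :=
  (natSum_lt_natSum_left h₂ a).trans_le (natSum_le_natSum h₁ le_rfl)

theorem natSum_lt_natSum_of_lt_of_le {a b c d : Ordinal.{u}} (h₁ : a < b) (h₂ : c ≤ d) :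
    natSum a c < natSum b d :=
  (natSum_lt_natSum_right h₁ c).trans_le (natSum_le_natSum le_rfl h₂)

theorem le_of_natSum_le_natSum_right {a b c : Ordinal.{u}} (h : natSum a c ≤ natSum b c) :
    a ≤ b :=
  not_lt.1 fun hba => h.not_gt (natSum_lt_natSum_right hba c)

theorem natSum_eq_add {a b : Ordinal.{u}}
    (h : ∀ e ∈ (cnfCoeff a).support, ∀ e' ∈ (cnfCoeff b).support, e' ≤ e) :
    natSum a b = a + b := by
  rw [natSum, ofCnfCoeff_add h, ofCnfCoeff_cnfCoeff, ofCnfCoeff_cnfCoeff]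

theorem add_le_natSum (a b : Ordinal.{u}) : a + b ≤ natSum a b := by
  induction b using WellFoundedLT.induction with
  | ind b ih =>
    rcases eq_or_ne b 0 with rfl | hb
    · simp
    · refine le_of_forall_lt fun c hc => ?_
      obtain ⟨d, hd, hcd⟩ := (Ordinal.lt_add_iff hb).1 hc
      exact hcd.trans_lt ((ih d hd).trans_lt (natSum_lt_natSum_left hd a))

/-- Every nonzero ordinal splits off the last term of its Cantor normal form. -/
theorem exists_eq_natSum_opow {a : Ordinal.{u}} (ha : a ≠ 0) :
    ∃ b e : Ordinal.{u}, a = natSum b (Ordinal.omega0 ^ e) ∧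
      a = b + Ordinal.omega0 ^ e ∧ ∀ e' ∈ (cnfCoeff a).support, e ≤ e' := by
  obtain ⟨b, e, hab, he⟩ := exists_cnfCoeff_eq_add_single ha
  have h : a = natSum b (Ordinal.omega0 ^ e) := cnfCoeff_injective (by simp [hab])
  refine ⟨b, e, h, ?_, he⟩
  conv_lhs => rw [h]
  refine natSum_eq_add fun i hi j hj => ?_
  rw [cnfCoeff_opow] at hj
  rw [Finset.mem_singleton.1 (Finsupp.support_single_subset hj)]
  refine he i ?_
  rw [hab]
  exact Finsupp.support_mono le_self_add hi

theorem lt_natSum_opow {a e : Ordinal.{u}} : a < natSum a (Ordinal.omega0 ^ e) := by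
  simpa using natSum_lt_natSum_left (Ordinal.opow_pos e Ordinal.omega0_pos) a

/-- Powers of `ω` are closed under natural sums. -/
theorem natSum_lt_opow {a b e : Ordinal.{u}} (ha : a < Ordinal.omega0 ^ e)
    (hb : b < Ordinal.omega0 ^ e) : natSum a b < Ordinal.omega0 ^ e := by
  have key : ∀ {c : Ordinal.{u}}, c < Ordinal.omega0 ^ e → ∀ i ∈ (cnfCoeff c).support, i < e := by
    intro c hc i hi
    have hle : Ordinal.omega0 ^ i ≤ c := by
      rw [← toColex_cnfCoeff_le_iff, cnfCoeff_opow]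
      refine Finsupp.toColex_monotone ?_
      rw [Finsupp.single_le_iff, Nat.one_le_iff_ne_zero]
      exact Finsupp.mem_support_iff.1 hi
    exact (Ordinal.opow_lt_opow_iff_right Ordinal.one_lt_omega0).1 (hle.trans_lt hc)
  refine ofCnfCoeff_lt_opow fun i hi => ?_
  rcases Finset.mem_union.1 (Finsupp.support_add hi) with h | h
  exacts [key ha i h, key hb i h]

/-- An ordinal below a natural sum is at most a natural sum in which one summand has been
decreased. -/
theorem exists_le_natSum_of_lt_natSum {a b c : Ordinal.{u}} (h : c < natSum a b) :
    (∃ a' < a, c ≤ natSum a' b) ∨ ∃ b' < b, c ≤ natSum a b' := by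
  rcases eq_or_ne (natSum a b) 0 with h0 | h0
  · simp [h0] at h
  obtain ⟨w, s, hw, hw', -⟩ := exists_eq_natSum_opow h0
  have hs : s ∈ (cnfCoeff a + cnfCoeff b).support := by
    rw [← cnfCoeff_natSum, hw]
    simp
  -- `ω ^ s` is the last term of `a ⊕ b`, hence a term of `a` or of `b`.
  have key : ∀ {a b : Ordinal.{u}}, natSum a b = natSum w (Ordinal.omega0 ^ s) →
      s ∈ (cnfCoeff a).support → ∃ a' < a, c ≤ natSum a' b := by
    intro a b hab hs
    have hle : Finsupp.single s 1 ≤ cnfCoeff a := by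
      rw [Finsupp.single_le_iff, Nat.one_le_iff_ne_zero]
      exact Finsupp.mem_support_iff.1 hs
    let a₀ := ofCnfCoeff (cnfCoeff a - Finsupp.single s 1)
    have ha₀ : a = natSum a₀ (Ordinal.omega0 ^ s) := by
      refine cnfCoeff_injective ?_
      simp [a₀, cnfCoeff_ofCnfCoeff, tsub_add_cancel_of_le hle]
    have hw₀ : w = natSum a₀ b := by
      refine cnfCoeff_injective (add_right_cancel (b := Finsupp.single s 1) ?_)
      have := congrArg cnfCoeff hab
      rw [ha₀] at this
      simp only [cnfCoeff_natSum, cnfCoeff_opow] at this ⊢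
      rw [← this]
      abel
    have hcs : c - w < Ordinal.omega0 ^ s :=
      Ordinal.sub_lt_of_lt_add (hw' ▸ h) (Ordinal.opow_pos s Ordinal.omega0_pos)
    refine ⟨natSum a₀ (c - w), ?_, ?_⟩
    · rw [ha₀]
      exact natSum_lt_natSum_left hcs a₀
    · calc c ≤ w + (c - w) := Ordinal.le_add_sub c w
        _ ≤ natSum w (c - w) := add_le_natSum _ _
        _ = natSum (natSum a₀ (c - w)) b := by
          rw [hw₀, natSum_assoc, natSum_assoc, natSum_comm b]
  rcases Finset.mem_union.1 (Finsupp.support_add hs) with hs | hs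
  · exact Or.inl (key hw hs)
  · obtain ⟨b', hb', hc⟩ := key ((natSum_comm b a).trans hw) hs
    exact Or.inr ⟨b', hb', natSum_comm a b' ▸ hc⟩

/-! ### The natural product -/

/-- The product of two Cantor normal forms, as a bilinear operation on their coefficients. -/
noncomputable def cnfMul (f g : Ordinal.{u} →₀ ℕ) : Ordinal.{u} →₀ ℕ :=
  f.sum fun e m => g.sum fun e' n => Finsupp.single (natSum e e') (m * n)

@[simp]
theorem cnfCoeff_natProd (a b : Ordinal.{u}) :
    cnfCoeff (natProd a b) = cnfMul (cnfCoeff a) (cnfCoeff b) :=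
  cnfCoeff_ofCnfCoeff _

theorem cnfMul_comm (f g : Ordinal.{u} →₀ ℕ) : cnfMul f g = cnfMul g f := by
  rw [cnfMul, Finsupp.sum_comm]
  simp only [cnfMul, mul_comm, natSum_comm]

@[simp]
theorem zero_cnfMul (g : Ordinal.{u} →₀ ℕ) : cnfMul 0 g = 0 :=
  Finsupp.sum_zero_index

@[simp]
theorem cnfMul_zero (f : Ordinal.{u} →₀ ℕ) : cnfMul f 0 = 0 := by
  rw [cnfMul_comm, zero_cnfMul]

theorem add_cnfMul (f f' g : Ordinal.{u} →₀ ℕ) :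
    cnfMul (f + f') g = cnfMul f g + cnfMul f' g := by
  refine Finsupp.sum_add_index' (fun e => ?_) fun e m m' => ?_
  · simp
  · simp [add_mul]

theorem cnfMul_add (f g g' : Ordinal.{u} →₀ ℕ) :
    cnfMul f (g + g') = cnfMul f g + cnfMul f g' := by
  rw [cnfMul_comm, add_cnfMul, cnfMul_comm g, cnfMul_comm g']

@[simp]
theorem cnfMul_single_single (e e' : Ordinal.{u}) (m n : ℕ) :
    cnfMul (Finsupp.single e m) (Finsupp.single e' n) =
      Finsupp.single (natSum e e') (m * n) := by
  simp [cnfMul]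

theorem exists_of_mem_support_cnfMul {f g : Ordinal.{u} →₀ ℕ} {i : Ordinal.{u}}
    (hi : i ∈ (cnfMul f g).support) :
    ∃ e ∈ f.support, ∃ e' ∈ g.support, i = natSum e e' := by
  obtain ⟨e, he, hi⟩ := Finset.mem_biUnion.1 (Finsupp.support_sum hi)
  obtain ⟨e', he', hi⟩ := Finset.mem_biUnion.1 (Finsupp.support_sum hi)
  exact ⟨e, he, e', he', Finset.mem_singleton.1 (Finsupp.support_single_subset hi)⟩

theorem cnfMul_single_one (f : Ordinal.{u} →₀ ℕ) (e : Ordinal.{u}) :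
    cnfMul f (Finsupp.single e 1) = f.mapDomain (natSum · e) := by
  refine Finsupp.sum_congr fun e' _ => ?_
  rw [Finsupp.sum_single_index (by simp), mul_one]

theorem natProd_comm (a b : Ordinal.{u}) : natProd a b = natProd b a :=
  cnfCoeff_injective (by simp [cnfMul_comm])

@[simp]
theorem natProd_zero (a : Ordinal.{u}) : natProd a 0 = 0 :=
  cnfCoeff_injective (by simp)

@[simp]
theorem zero_natProd (a : Ordinal.{u}) : natProd 0 a = 0 :=
  cnfCoeff_injective (by simp)

theorem natSum_natProd (a b c : Ordinal.{u}) :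
    natProd (natSum a b) c = natSum (natProd a c) (natProd b c) :=
  cnfCoeff_injective (by simp [add_cnfMul])

theorem natProd_natSum (a b c : Ordinal.{u}) :
    natProd a (natSum b c) = natSum (natProd a b) (natProd a c) :=
  cnfCoeff_injective (by simp [cnfMul_add])

theorem natProd_opow_opow (a b : Ordinal.{u}) :
    natProd (Ordinal.omega0 ^ a) (Ordinal.omega0 ^ b) = Ordinal.omega0 ^ natSum a b :=
  cnfCoeff_injective (by simp)

/-- Multiplying by `ω ^ e` shifts the exponents by the strictly increasing map `· ⊕ e`. -/
theorem natProd_opow_lt_natProd_opow {a b : Ordinal.{u}} (h : a < b) (e : Ordinal.{u}) :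
    natProd a (Ordinal.omega0 ^ e) < natProd b (Ordinal.omega0 ^ e) := by
  have hmono : StrictMono (natSum · e) := fun _ _ h => natSum_lt_natSum_right h e
  rw [← toColex_cnfCoeff_lt_iff] at h ⊢
  obtain ⟨i, hi, hlt⟩ := Finsupp.Colex.lt_iff.1 h
  simp only [cnfCoeff_natProd, cnfCoeff_opow, cnfMul_single_one]
  refine Finsupp.Colex.lt_iff.2 ⟨natSum i e, fun j hj => ?_, ?_⟩
  · change (cnfCoeff a).mapDomain (natSum · e) j = (cnfCoeff b).mapDomain (natSum · e) j
    by_cases hr : j ∈ Set.range (natSum · e)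
    · obtain ⟨j, rfl⟩ := hr
      rw [Finsupp.mapDomain_apply hmono.injective, Finsupp.mapDomain_apply hmono.injective]
      exact hi j (hmono.lt_iff_lt.1 hj)
    · rw [Finsupp.mapDomain_of_notMem_range _ _ hr, Finsupp.mapDomain_of_notMem_range _ _ hr]
  · change (cnfCoeff a).mapDomain (natSum · e) (natSum i e) <
      (cnfCoeff b).mapDomain (natSum · e) (natSum i e)
    rw [Finsupp.mapDomain_apply hmono.injective (a := i),
      Finsupp.mapDomain_apply hmono.injective (a := i)]
    exact hlt

theorem natProd_le_natProd_right {a b : Ordinal.{u}} (h : a ≤ b) (c : Ordinal.{u}) :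
    natProd a c ≤ natProd b c := by
  induction c using WellFoundedLT.induction with
  | ind c ih =>
    rcases eq_or_ne c 0 with rfl | hc
    · simp
    · obtain ⟨d, e, hd, -, -⟩ := exists_eq_natSum_opow hc
      rw [hd, natProd_natSum, natProd_natSum]
      refine natSum_le_natSum (ih d (hd ▸ lt_natSum_opow)) ?_
      exact (StrictMono.monotone fun _ _ h => natProd_opow_lt_natProd_opow h e) h

theorem natProd_le_natProd {a b c d : Ordinal.{u}} (h₁ : a ≤ b) (h₂ : c ≤ d) :
    natProd a c ≤ natProd b d := by
  refine (natProd_le_natProd_right h₁ c).trans ?_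
  rw [natProd_comm b c, natProd_comm b d]
  exact natProd_le_natProd_right h₂ b

/-- Conway's recursive bound for the natural product: everything below `a ⊗ b` is bounded by an
expression `a' ⊗ b ⊕ a ⊗ b' ⊖ a' ⊗ b'` with `a' < a` and `b' < b`. -/
theorem exists_natSum_natProd_le {a b c : Ordinal.{u}} (h : c < natProd a b) :
    ∃ a' < a, ∃ b' < b,
      natSum c (natProd a' b') ≤ natSum (natProd a' b) (natProd a b') := by
  rcases eq_or_ne a 0 with rfl | ha
  · simp at h
  rcases eq_or_ne b 0 with rfl | hb
  · simp at h
  obtain ⟨a₀, p, ha₀, -, hp⟩ := exists_eq_natSum_opow ha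
  obtain ⟨b₀, q, hb₀, -, hq⟩ := exists_eq_natSum_opow hb
  -- `a ⊗ b = z ⊕ ω ^ (p ⊕ q)`, where `p ⊕ q` is the smallest exponent.
  let z := natSum (natProd a₀ b) (natProd (Ordinal.omega0 ^ p) b₀)
  have hz : natProd a b = natSum z (Ordinal.omega0 ^ natSum p q) := by
    conv_lhs => rw [ha₀, natSum_natProd]
    conv_lhs => enter [2]; rw [hb₀, natProd_natSum, natProd_opow_opow]
    rw [← natSum_assoc]
  have hz' : natProd a b = z + Ordinal.omega0 ^ natSum p q := by
    rw [hz]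
    refine natSum_eq_add fun i hi j hj => ?_
    rw [cnfCoeff_opow] at hj
    rw [Finset.mem_singleton.1 (Finsupp.support_single_subset hj)]
    have hi' : i ∈ (cnfMul (cnfCoeff a) (cnfCoeff b)).support := by
      rw [← cnfCoeff_natProd, hz, cnfCoeff_natSum]
      exact Finsupp.support_mono le_self_add hi
    obtain ⟨e, he, e', he', rfl⟩ := exists_of_mem_support_cnfMul hi'
    exact natSum_le_natSum (hp e he) (hq e' he')
  have hcz : c - z < Ordinal.omega0 ^ natSum p q :=
    Ordinal.sub_lt_of_lt_add (hz' ▸ h) (Ordinal.opow_pos _ Ordinal.omega0_pos)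
  have hc : c ≤ natSum z (c - z) := (Ordinal.le_add_sub c z).trans (add_le_natSum _ _)
  -- The remainder `c - z` is dominated by lowering one of the two last terms.
  have hrem : (∃ x < Ordinal.omega0 ^ p, c - z ≤ natProd x (Ordinal.omega0 ^ q)) ∨
      ∃ y < Ordinal.omega0 ^ q, c - z ≤ natProd (Ordinal.omega0 ^ p) y := by
    rcases eq_or_ne (natSum p q) 0 with h0 | h0
    · rw [h0, Ordinal.opow_zero, Order.lt_one_iff] at hcz
      exact Or.inl ⟨0, Ordinal.opow_pos _ Ordinal.omega0_pos, by simp [hcz]⟩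
    · obtain ⟨r, hr, n, hn⟩ := (Ordinal.lt_omega0_opow h0).1 hcz
      rcases exists_le_natSum_of_lt_natSum hr with ⟨p', hp', hr'⟩ | ⟨q', hq', hr'⟩
      · refine Or.inl ⟨Ordinal.omega0 ^ p' * n, 
          Ordinal.opow_mul_lt_opow (Ordinal.natCast_lt_omega0 n) hp', ?_⟩
        have : natProd (Ordinal.omega0 ^ p' * n) (Ordinal.omega0 ^ q) =
            Ordinal.omega0 ^ natSum p' q * n :=
          cnfCoeff_injective (by simp [cnfCoeff_opow_mul])
        rw [this]
        exact hn.le.trans (mul_le_mul_left (Ordinal.opow_le_opow_right Ordinal.omega0_pos hr') _)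
      · refine Or.inr ⟨Ordinal.omega0 ^ q' * n, 
          Ordinal.opow_mul_lt_opow (Ordinal.natCast_lt_omega0 n) hq', ?_⟩
        have : natProd (Ordinal.omega0 ^ p) (Ordinal.omega0 ^ q' * n) =
            Ordinal.omega0 ^ natSum p q' * n :=
          cnfCoeff_injective (by simp [cnfCoeff_opow_mul])
        rw [this]
        exact hn.le.trans (mul_le_mul_left (Ordinal.opow_le_opow_right Ordinal.omega0_pos hr') _)
  rcases hrem with ⟨x, hx, hxc⟩ | ⟨y, hy, hyc⟩
  · refine ⟨natSum a₀ x, ha₀ ▸ natSum_lt_natSum_left hx a₀, b₀, hb₀ ▸ lt_natSum_opow, ?_⟩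
    refine (natSum_le_natSum (hc.trans (natSum_le_natSum le_rfl hxc)) le_rfl).trans_eq ?_
    refine cnfCoeff_injective ?_
    have ha₁ := congrArg cnfCoeff ha₀
    have hb₁ := congrArg cnfCoeff hb₀
    simp only [cnfCoeff_natSum, cnfCoeff_natProd, z] at ha₁ hb₁ ⊢
    rw [ha₁, hb₁]
    simp only [add_cnfMul, cnfMul_add]
    abel
  · refine ⟨a₀, ha₀ ▸ lt_natSum_opow, natSum b₀ y, hb₀ ▸ natSum_lt_natSum_left hy b₀, ?_⟩
    refine (natSum_le_natSum (hc.trans (natSum_le_natSum le_rfl hyc)) le_rfl).trans_eq ?_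
    refine cnfCoeff_injective ?_
    have ha₁ := congrArg cnfCoeff ha₀
    have hb₁ := congrArg cnfCoeff hb₀
    simp only [cnfCoeff_natSum, cnfCoeff_natProd, z] at ha₁ hb₁ ⊢
    rw [ha₁, hb₁]
    simp only [add_cnfMul, cnfMul_add]
    abel

/-! ### Ranks in well-founded posets -/

section Rank

variable {P : Type u} [PartialOrder P] [WellFoundedLT P]

/-- The rank of an element of a well-founded poset. -/
noncomputable def rk (x : P) : Ordinal.{u} :=
  IsWellFounded.rank (fun y z : P => y < z) x

theorem rk_strictMono : StrictMono (rk : P → Ordinal.{u}) :=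
  WellFoundedLT.rank_strictMono

theorem exists_lt_rk_eq {x : P} {o : Ordinal.{u}} (h : o < rk x) : ∃ y < x, rk y = o := by
  induction x using WellFoundedLT.induction with
  | ind x ih =>
    have hx := h
    rw [rk, IsWellFounded.rank_eq, Ordinal.lt_iSup_iff] at hx
    obtain ⟨⟨y, hy⟩, ho⟩ := hx
    rcases (Order.lt_succ_iff.1 ho).eq_or_lt with rfl | ho
    · exact ⟨y, hy, rfl⟩
    · obtain ⟨z, hz, hzo⟩ := ih y hy ho
      exact ⟨z, hz.trans hy, hzo⟩

/-- The rank is the smallest strictly increasing ordinal-valued function, also when strict increase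
holds only below the element in question. -/
theorem rk_le_of_lt_of_lt {φ : P → Ordinal.{u}} {x : P}
    (hφ : ∀ z ≤ x, ∀ y < z, φ y < φ z) : rk x ≤ φ x := by
  induction x using WellFoundedLT.induction with
  | ind x ih =>
    refine le_of_forall_lt fun o ho => ?_
    obtain ⟨y, hy, rfl⟩ := exists_lt_rk_eq ho
    exact (ih y hy fun z hz => hφ z (hz.trans hy.le)).trans_lt (hφ x le_rfl y hy)

theorem add_rk_le_of_strictMono {φ : P → Ordinal.{u}} (hφ : StrictMono φ) {o : Ordinal.{u}}
    (ho : ∀ x, o ≤ φ x) (x : P) : o + rk x ≤ φ x := by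
  induction x using WellFoundedLT.induction with
  | ind x ih =>
    rcases eq_or_ne (rk x) 0 with h0 | h0
    · simpa [h0] using ho x
    · refine le_of_forall_lt fun c hc => ?_
      obtain ⟨d, hd, hcd⟩ := (Ordinal.lt_add_iff h0).1 hc
      obtain ⟨y, hy, rfl⟩ := exists_lt_rk_eq hd
      exact hcd.trans_lt ((ih y hy).trans_lt (hφ hy))

theorem lift_rk_le_of_strictMono {Q : Type v} [PartialOrder Q] [WellFoundedLT Q] {f : P → Q}
    (hf : StrictMono f) (x : P) :
    Ordinal.lift.{v} (rk x) ≤ Ordinal.lift.{u} (rk (f x)) := by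
  induction x using WellFoundedLT.induction with
  | ind x ih =>
    refine le_of_forall_lt fun c hc => ?_
    obtain ⟨o, ho, rfl⟩ := Ordinal.lt_lift_iff.1 hc
    obtain ⟨y, hy, rfl⟩ := exists_lt_rk_eq ho
    exact (ih y hy).trans_lt (Ordinal.lift_lt.2 (rk_strictMono (hf hy)))

end Rank

/-- Supermodularity of the rank. Lowering `x` strictly lowers at least one of `x ⊔ y` and `x ⊓ y`,
because in a distributive lattice these two determine `x` for given `y`. -/
theorem natSum_rk_le {L : Type u} [DistribLattice L] [WellFoundedLT L] (x y : L) :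
    natSum (rk x) (rk y) ≤ natSum (rk (x ⊔ y)) (rk (x ⊓ y)) := by
  have key : ∀ {x x' : L}, x' < x → ∀ y, natSum (rk (x' ⊔ y)) (rk (x' ⊓ y)) <
      natSum (rk (x ⊔ y)) (rk (x ⊓ y)) := by
    intro x x' hx y
    have h₁ : x' ⊔ y ≤ x ⊔ y := sup_le_sup_right hx.le y
    have h₂ : x' ⊓ y ≤ x ⊓ y := inf_le_inf_right y hx.le
    rcases h₁.lt_or_eq with h₁ | h₁
    · exact natSum_lt_natSum_of_lt_of_le (rk_strictMono h₁) (rk_strictMono.monotone h₂)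
    · refine natSum_lt_natSum_of_le_of_lt (rk_strictMono.monotone h₁.le)
        (rk_strictMono (h₂.lt_of_ne fun h => ?_))
      exact hx.not_ge (le_of_inf_le_sup_le h.ge h₁.ge)
  induction x using WellFoundedLT.induction generalizing y with
  | ind x ihx =>
    induction y using WellFoundedLT.induction with
    | ind y ihy =>
      refine le_of_forall_lt fun c hc => ?_
      rcases exists_le_natSum_of_lt_natSum hc with ⟨a, ha, hca⟩ | ⟨b, hb, hcb⟩
      · obtain ⟨x', hx', rfl⟩ := exists_lt_rk_eq ha
        exact (hca.trans (ihx x' hx' y)).trans_lt (key hx' y)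
      · obtain ⟨y', hy', rfl⟩ := exists_lt_rk_eq hb
        refine (hcb.trans (ihy y' hy')).trans_lt ?_
        rw [sup_comm x, inf_comm x, sup_comm x, inf_comm x]
        exact key hy' x

/-! ### Stature of Noetherian spaces -/

open TopologicalSpace

theorem stature_eq_rk_top (X : Type u) [TopologicalSpace X] [NoetherianSpace X] :
    stature X = rk (⊤ : Closeds X) := by
  have h : ordinalRank (Closeds X) = rk (⊤ : Closeds X) + 1 := by
    refine le_antisymm (Ordinal.iSup_le fun C => ?_) ?_
    · rw [← Order.succ_eq_add_one]
      exact Order.succ_le_succ (rk_strictMono.monotone le_top)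
    · rw [← Order.succ_eq_add_one]
      exact Ordinal.le_iSup (fun C : Closeds X => Order.succ (rk C)) ⊤
  rw [stature, h, Ordinal.pred_add_one]

theorem rk_le_stature {X : Type u} [TopologicalSpace X] [NoetherianSpace X] (C : Closeds X) :
    rk C ≤ stature X := by
  rw [stature_eq_rk_top]
  exact rk_strictMono.monotone le_top

theorem rk_lt_stature {X : Type u} [TopologicalSpace X] [NoetherianSpace X] {C : Closeds X}
    (h : C < ⊤) : rk C < stature X := by
  rw [stature_eq_rk_top]
  exact rk_strictMono h

theorem lift_stature_le_of_surjective {X : Type u} {Y : Type v} [TopologicalSpace X]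
    [NoetherianSpace X] [TopologicalSpace Y] [NoetherianSpace Y] {f : X → Y}
    (hf : Continuous f) (hs : Function.Surjective f) :
    Ordinal.lift.{u} (stature Y) ≤ Ordinal.lift.{v} (stature X) := by
  have hmono : StrictMono fun C : Closeds Y => C.preimage hf := by
    intro C D h
    obtain ⟨y, hyD, hyC⟩ := Set.exists_of_ssubset (SetLike.coe_ssubset_coe.2 h)
    obtain ⟨x, rfl⟩ := hs y
    exact SetLike.lt_iff_le_and_exists.2 ⟨fun z hz => h.le hz, x, hyD, hyC⟩
  rw [stature_eq_rk_top X, stature_eq_rk_top Y]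
  exact lift_rk_le_of_strictMono hmono ⊤

theorem lift_stature_eq_of_homeomorph {X : Type u} {Y : Type v} [TopologicalSpace X]
    [NoetherianSpace X] [TopologicalSpace Y] [NoetherianSpace Y] (e : X ≃ₜ Y) :
    Ordinal.lift.{v} (stature X) = Ordinal.lift.{u} (stature Y) :=
  le_antisymm (lift_stature_le_of_surjective e.symm.continuous e.symm.surjective)
    (lift_stature_le_of_surjective e.continuous e.surjective)

section Subspaces

variable {X : Type u} [TopologicalSpace X] [NoetherianSpace X]

theorem stature_coe_le_rk (D : Closeds X) : stature (D : Set X) ≤ rk D := by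
  let F : Closeds (D : Set X) → Closeds X := fun C =>
    ⟨Subtype.val '' (C : Set (D : Set X)),
      D.isClosed.isClosedEmbedding_subtypeVal.isClosedMap _ C.isClosed⟩
  have hF : StrictMono F := fun A B h =>
    SetLike.coe_ssubset_coe.1
      (Subtype.val_injective.image_strictMono (SetLike.coe_ssubset_coe.2 h))
  have htop : F ⊤ = D := by
    ext x
    simp [F]
  have := lift_rk_le_of_strictMono hF ⊤
  rw [htop] at this
  rw [stature_eq_rk_top]
  simpa using this

/-- A closed set covered by the image of a continuous map has rank at most the stature of the
source. -/
theorem rk_le_stature_of_subset_range {A : Type u} [TopologicalSpace A] [NoetherianSpace A]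
    {f : A → X} (hf : Continuous f) {K : Closeds X} (hK : (K : Set X) ⊆ Set.range f) :
    rk K ≤ stature A := by
  refine (rk_le_of_lt_of_lt (φ := fun K => rk (K.preimage hf)) fun L hL M hM => ?_).trans
    (rk_le_stature _)
  obtain ⟨x, hxL, hxM⟩ := Set.exists_of_ssubset (SetLike.coe_ssubset_coe.2 hM)
  obtain ⟨a, rfl⟩ := hK (hL hxL)
  exact rk_strictMono (SetLike.lt_iff_le_and_exists.2
    ⟨fun b hb => hM.le hb, a, hxL, hxM⟩)

/-- Subadditivity of the rank: a strict inclusion of closed sets remains strict on at least one of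
the two covering pieces. -/
theorem rk_le_natSum_of_subset_range {A B : Type u} [TopologicalSpace A] [NoetherianSpace A]
    [TopologicalSpace B] [NoetherianSpace B] {f : A → X} {g : B → X} (hf : Continuous f)
    (hg : Continuous g) {K : Closeds X} (hK : (K : Set X) ⊆ Set.range f ∪ Set.range g) :
    rk K ≤ natSum (stature A) (stature B) := by
  refine (rk_le_of_lt_of_lt
    (φ := fun K => natSum (rk (K.preimage hf)) (rk (K.preimage hg))) fun L hL M hM => ?_).trans
    (natSum_le_natSum (rk_le_stature _) (rk_le_stature _))
  have hMf : M.preimage hf ≤ L.preimage hf := fun a ha => hM.le ha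
  have hMg : M.preimage hg ≤ L.preimage hg := fun b hb => hM.le hb
  obtain ⟨x, hxL, hxM⟩ := Set.exists_of_ssubset (SetLike.coe_ssubset_coe.2 hM)
  rcases hK (hL hxL) with ⟨a, rfl⟩ | ⟨b, rfl⟩
  · exact natSum_lt_natSum_of_lt_of_le
      (rk_strictMono (SetLike.lt_iff_le_and_exists.2 ⟨hMf, a, hxL, hxM⟩))
      (rk_strictMono.monotone hMg)
  · exact natSum_lt_natSum_of_le_of_lt (rk_strictMono.monotone hMf)
      (rk_strictMono (SetLike.lt_iff_le_and_exists.2 ⟨hMg, b, hxL, hxM⟩))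

/-- The closed subsets of the complement of `D` embed, by adjoining `D`, into the closed subsets of
`X` that contain `D`. -/
theorem rk_add_stature_compl_le (D : Closeds X) :
    rk D + stature ((D : Set X)ᶜ : Set X) ≤ stature X := by
  let F : Closeds ((D : Set X)ᶜ : Set X) → Closeds X := fun C =>
    D ⊔ Closeds.closure (Subtype.val '' (C : Set ((D : Set X)ᶜ : Set X)))
  have hF : StrictMono F := by
    intro A B h
    obtain ⟨x, hxB, hxA⟩ := Set.exists_of_ssubset (SetLike.coe_ssubset_coe.2 h)
    refine SetLike.lt_iff_le_and_exists.2 ⟨?_, (x : X), ?_, ?_⟩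
    · exact sup_le_sup_left (Closeds.gc.monotone_l (Set.image_mono h.le)) D
    · rw [← SetLike.mem_coe, Closeds.coe_sup]
      exact Or.inr (subset_closure ⟨x, hxB, rfl⟩)
    · rw [← SetLike.mem_coe, Closeds.coe_sup]
      rintro (hx | hx)
      · exact x.2 hx
      · refine hxA ?_
        have : x ∈ closure (A : Set ((D : Set X)ᶜ : Set X)) := by
          rw [Topology.IsInducing.subtypeVal.closure_eq_preimage_closure_image]
          exact hx
        rwa [A.isClosed.closure_eq] at this
  rw [stature_eq_rk_top ((D : Set X)ᶜ : Set X)]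
  refine (add_rk_le_of_strictMono (rk_strictMono.comp hF) (fun C => ?_) ⊤).trans (rk_le_stature _)
  exact rk_strictMono.monotone le_sup_left

end Subspaces

/-! ### Stature of a product -/

open TopologicalSpace

/-- Points outside a closed set of the product have a rectangular open neighbourhood avoiding it. -/
theorem exists_subset_union_of_lt_top {X : Type u} {Y : Type v} [TopologicalSpace X]
    [TopologicalSpace Y] {K : Closeds (X × Y)} (hK : K < ⊤) :
    ∃ C : Closeds X, ∃ D : Closeds Y, C < ⊤ ∧ D < ⊤ ∧
      ∀ p ∈ K, p.1 ∈ C ∨ p.2 ∈ D := by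
  obtain ⟨⟨x, y⟩, -, hp⟩ := Set.exists_of_ssubset (SetLike.coe_ssubset_coe.2 hK)
  obtain ⟨U, V, hU, hV, hx, hy, hUV⟩ := isOpen_prod_iff.1 K.isClosed.isOpen_compl x y hp
  refine ⟨⟨Uᶜ, hU.isClosed_compl⟩, ⟨Vᶜ, hV.isClosed_compl⟩,
    SetLike.lt_iff_le_and_exists.2 ⟨le_top, x, trivial, fun h => h hx⟩,
    SetLike.lt_iff_le_and_exists.2 ⟨le_top, y, trivial, fun h => h hy⟩, fun p hp => ?_⟩
  by_contra h
  push Not at h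
  exact hUV ⟨not_not.1 h.1, not_not.1 h.2⟩ hp

section Product

variable {X Y : Type u} [TopologicalSpace X] [NoetherianSpace X] [TopologicalSpace Y]
  [NoetherianSpace Y]

theorem stature_prod_le_of_closed_left (C : Closeds X) :
    stature (X × Y) ≤
      natSum (stature (↥(C : Set X) × Y)) (stature (↥((C : Set X)ᶜ) × Y)) := by
  rw [stature_eq_rk_top]
  refine rk_le_natSum_of_subset_range (f := Prod.map Subtype.val id) (g := Prod.map Subtype.val id)
    (continuous_subtype_val.prodMap continuous_id) (continuous_subtype_val.prodMap continuous_id)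
    fun p _ => ?_
  by_cases hp : p.1 ∈ (C : Set X)
  · exact Or.inl ⟨(⟨p.1, hp⟩, p.2), rfl⟩
  · exact Or.inr ⟨(⟨p.1, hp⟩, p.2), rfl⟩

theorem stature_prod_comm : stature (X × Y) = stature (Y × X) := by
  simpa using lift_stature_eq_of_homeomorph (Homeomorph.prodComm X Y)

end Product

/-- A final term `ω ^ p` of the stature can be split off by cutting `X` along a closed set. -/
theorem exists_closed_of_stature_eq {X : Type u} [TopologicalSpace X] [NoetherianSpace X]
    {a p : Ordinal.{u}} (ha : stature X = a + Ordinal.omega0 ^ p) :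
    ∃ C : Closeds X, stature (C : Set X) ≤ a ∧
      stature ((C : Set X)ᶜ : Set X) ≤ Ordinal.omega0 ^ p := by
  have hlt : a < rk (⊤ : Closeds X) := by
    rw [← stature_eq_rk_top, ha]
    exact lt_add_of_pos_right a (Ordinal.opow_pos p Ordinal.omega0_pos)
  obtain ⟨C, -, rfl⟩ := exists_lt_rk_eq hlt
  exact ⟨C, stature_coe_le_rk C, (add_le_add_iff_left _).1 (ha ▸ rk_add_stature_compl_le C)⟩

/-- The upper bound when both statures are powers of `ω`. Every proper closed subset of the product
lies in some `C × Y ∪ X × D` with `C` and `D` proper, whose two pieces have rank below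
`ω ^ (p ⊕ q)`. -/
theorem stature_prod_le_opow {X Y : Type u} [TopologicalSpace X] [NoetherianSpace X]
    [TopologicalSpace Y] [NoetherianSpace Y] {p q : Ordinal.{u}}
    (hX : stature X = Ordinal.omega0 ^ p) (hY : stature Y = Ordinal.omega0 ^ q)
    (hl : ∀ C : Closeds X, C < ⊤ →
      stature (↥(C : Set X) × Y) ≤ natProd (rk C) (Ordinal.omega0 ^ q))
    (hr : ∀ D : Closeds Y, D < ⊤ →
      stature (X × (D : Set Y)) ≤ natProd (Ordinal.omega0 ^ p) (rk D)) :
    stature (X × Y) ≤ natProd (Ordinal.omega0 ^ p) (Ordinal.omega0 ^ q) := by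
  rw [stature_eq_rk_top]
  refine le_of_forall_lt fun c hc => ?_
  obtain ⟨K, hK, rfl⟩ := exists_lt_rk_eq hc
  obtain ⟨C, D, hC, hD, hKCD⟩ := exists_subset_union_of_lt_top hK
  have hle : rk K ≤ natSum (stature (↥(C : Set X) × Y)) (stature (X × (D : Set Y))) := by
    refine rk_le_natSum_of_subset_range (f := Prod.map Subtype.val id)
      (g := Prod.map id Subtype.val) (continuous_subtype_val.prodMap continuous_id)
      (continuous_id.prodMap continuous_subtype_val) fun z hz => ?_
    rcases hKCD z hz with h | h
    · exact Or.inl ⟨(⟨z.1, h⟩, z.2), rfl⟩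
    · exact Or.inr ⟨(z.1, ⟨z.2, h⟩), rfl⟩
  refine hle.trans_lt ?_
  rw [natProd_opow_opow]
  refine natSum_lt_opow ((hl C hC).trans_lt ?_) ((hr D hD).trans_lt ?_)
  · rw [← natProd_opow_opow]
    exact natProd_opow_lt_natProd_opow (hX ▸ rk_lt_stature hC) q
  · rw [← natProd_opow_opow, natProd_comm, natProd_comm (Ordinal.omega0 ^ p)]
    exact natProd_opow_lt_natProd_opow (hY ▸ rk_lt_stature hD) p

/-- The upper bound. It is stated with inequalities in the hypotheses because the statures of the
two pieces of a cut are only bounded, not determined. -/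
theorem stature_prod_le_of_stature_le (a b : Ordinal.{u}) :
    ∀ (X Y : Type u) [TopologicalSpace X] [NoetherianSpace X] [TopologicalSpace Y]
      [NoetherianSpace Y], stature X ≤ a → stature Y ≤ b → stature (X × Y) ≤ natProd a b := by
  induction a using WellFoundedLT.induction generalizing b with
  | ind a iha =>
  induction b using WellFoundedLT.induction with
  | ind b ihb =>
  intro X Y _ _ _ _ hX hY
  rcases hX.lt_or_eq with hX | hX
  · exact (iha _ hX b X Y le_rfl hY).trans (natProd_le_natProd hX.le le_rfl)
  rcases hY.lt_or_eq with hY | hY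
  · exact (ihb _ hY X Y hX.le le_rfl).trans (natProd_le_natProd le_rfl hY.le)
  have hl : ∀ C : Closeds X, C < ⊤ → stature (↥(C : Set X) × Y) ≤ natProd (rk C) b :=
    fun C hC => iha _ (hX ▸ rk_lt_stature hC) b _ _ (stature_coe_le_rk C) hY.le
  have hr : ∀ D : Closeds Y, D < ⊤ → stature (X × (D : Set Y)) ≤ natProd a (rk D) :=
    fun D hD => ihb _ (hY ▸ rk_lt_stature hD) _ _ hX.le (stature_coe_le_rk D)
  rcases eq_or_ne a 0 with rfl | ha
  · rw [zero_natProd, stature_eq_rk_top]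
    refine le_of_forall_lt fun c hc => ?_
    obtain ⟨K, hK, rfl⟩ := exists_lt_rk_eq hc
    obtain ⟨C, -, hC, -⟩ := exists_subset_union_of_lt_top hK
    exact absurd (hX ▸ rk_lt_stature hC) not_lt_zero
  rcases eq_or_ne b 0 with rfl | hb
  · rw [natProd_zero, stature_eq_rk_top]
    refine le_of_forall_lt fun c hc => ?_
    obtain ⟨K, hK, rfl⟩ := exists_lt_rk_eq hc
    obtain ⟨-, D, -, hD, -⟩ := exists_subset_union_of_lt_top hK
    exact absurd (hY ▸ rk_lt_stature hD) not_lt_zero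
  obtain ⟨a₀, p, hap, hap', -⟩ := exists_eq_natSum_opow ha
  obtain ⟨b₀, q, hbq, hbq', -⟩ := exists_eq_natSum_opow hb
  rcases eq_or_ne a₀ 0 with rfl | ha₀
  · rcases eq_or_ne b₀ 0 with rfl | hb₀
    · rw [zero_add] at hap' hbq'
      rw [hap'] at hX hr ⊢
      rw [hbq'] at hY hl ⊢
      exact stature_prod_le_opow hX hY hl hr
    · obtain ⟨D, hD, hD'⟩ := exists_closed_of_stature_eq (hY.trans hbq')
      have h₀ : b₀ < b := hbq ▸ lt_natSum_opow
      have h₁ : Ordinal.omega0 ^ q < b := by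
        rw [hbq]
        simpa using natSum_lt_natSum_right (pos_iff_ne_zero.2 hb₀) (Ordinal.omega0 ^ q)
      calc stature (X × Y) = stature (Y × X) := stature_prod_comm
        _ ≤ natSum (stature (↥(D : Set Y) × X)) (stature (↥((D : Set Y)ᶜ) × X)) :=
          stature_prod_le_of_closed_left D
        _ = natSum (stature (X × (D : Set Y))) (stature (X × ((D : Set Y)ᶜ : Set Y))) := by
          rw [stature_prod_comm (X := X), stature_prod_comm (X := X)]
        _ ≤ natSum (natProd a b₀) (natProd a (Ordinal.omega0 ^ q)) :=
          natSum_le_natSum (ihb _ h₀ _ _ hX.le hD) (ihb _ h₁ _ _ hX.le hD')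
        _ = natProd a b := by rw [← natProd_natSum, ← hbq]
  · obtain ⟨C, hC, hC'⟩ := exists_closed_of_stature_eq (hX.trans hap')
    have h₀ : a₀ < a := hap ▸ lt_natSum_opow
    have h₁ : Ordinal.omega0 ^ p < a := by
      rw [hap]
      simpa using natSum_lt_natSum_right (pos_iff_ne_zero.2 ha₀) (Ordinal.omega0 ^ p)
    calc stature (X × Y)
        ≤ natSum (stature (↥(C : Set X) × Y)) (stature (↥((C : Set X)ᶜ) × Y)) :=
          stature_prod_le_of_closed_left C
      _ ≤ natSum (natProd a₀ b) (natProd (Ordinal.omega0 ^ p) b) :=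
          natSum_le_natSum (iha _ h₀ b _ _ hC hY.le) (iha _ h₁ b _ _ hC' hY.le)
      _ = natProd a b := by rw [← natSum_natProd, ← hap]

section Rectangles

variable {X Y : Type u} [TopologicalSpace X] [NoetherianSpace X] [TopologicalSpace Y]
  [NoetherianSpace Y]

theorem rk_prod_le (C : Closeds X) (D : Closeds Y) :
    rk (C ×ˢ D) ≤ natProd (rk C) (rk D) := by
  refine (rk_le_stature_of_subset_range (A := ↥(C : Set X) × (D : Set Y))
    (f := Prod.map Subtype.val Subtype.val)
    (continuous_subtype_val.prodMap continuous_subtype_val) fun p hp => ?_).trans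
    (stature_prod_le_of_stature_le _ _ _ _ (stature_coe_le_rk C) (stature_coe_le_rk D))
  exact ⟨(⟨p.1, hp.1⟩, ⟨p.2, hp.2⟩), rfl⟩

/-- The lower bound follows Conway's recursion: for `C' < C` and `D' < D`, the rectangles `C' × D`
and `C × D'` meet in `C' × D'`, and their union is a proper subset of `C × D`. -/
theorem le_rk_prod (C : Closeds X) (D : Closeds Y) :
    natProd (rk C) (rk D) ≤ rk (C ×ˢ D) := by
  induction C using WellFoundedLT.induction generalizing D with
  | ind C ihC =>
  induction D using WellFoundedLT.induction with
  | ind D ihD =>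
  refine le_of_forall_lt fun c hc => ?_
  obtain ⟨a, ha, b, hb, hab⟩ := exists_natSum_natProd_le hc
  obtain ⟨C', hC, rfl⟩ := exists_lt_rk_eq ha
  obtain ⟨D', hD, rfl⟩ := exists_lt_rk_eq hb
  have hinf : C' ×ˢ D ⊓ C ×ˢ D' = C' ×ˢ D' := by
    refine SetLike.ext fun p => ?_
    exact ⟨fun h => ⟨h.1.1, h.2.2⟩, fun h => ⟨⟨h.1, hD.le h.2⟩, ⟨hC.le h.1, h.2⟩⟩⟩
  have hlt : C' ×ˢ D ⊔ C ×ˢ D' < C ×ˢ D := by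
    obtain ⟨x, hx, hx'⟩ := Set.exists_of_ssubset (SetLike.coe_ssubset_coe.2 hC)
    obtain ⟨y, hy, hy'⟩ := Set.exists_of_ssubset (SetLike.coe_ssubset_coe.2 hD)
    refine SetLike.lt_iff_le_and_exists.2 ⟨sup_le (fun p h => ⟨hC.le h.1, h.2⟩)
      (fun p h => ⟨h.1, hD.le h.2⟩), (x, y),
      Closeds.mem_prod.2 ⟨hx, hy⟩, ?_⟩
    rw [← SetLike.mem_coe, Closeds.coe_sup]
    rintro (h | h)
    exacts [hx' h.1, hy' h.2]
  refine lt_of_le_of_lt ?_ (rk_strictMono hlt)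
  refine le_of_natSum_le_natSum_right (c := natProd (rk C') (rk D')) ?_
  calc natSum c (natProd (rk C') (rk D'))
      ≤ natSum (natProd (rk C') (rk D)) (natProd (rk C) (rk D')) := hab
    _ ≤ natSum (rk (C' ×ˢ D)) (rk (C ×ˢ D')) := natSum_le_natSum (ihC C' hC D) (ihD D' hD)
    _ ≤ natSum (rk (C' ×ˢ D ⊔ C ×ˢ D')) (rk (C' ×ˢ D ⊓ C ×ˢ D')) := natSum_rk_le _ _
    _ ≤ natSum (rk (C' ×ˢ D ⊔ C ×ˢ D')) (natProd (rk C') (rk D')) := by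
      rw [hinf]
      exact natSum_le_natSum le_rfl (rk_prod_le C' D')

theorem stature_prod (X Y : Type u) [TopologicalSpace X] [NoetherianSpace X] [TopologicalSpace Y]
    [NoetherianSpace Y] : stature (X × Y) = natProd (stature X) (stature Y) := by
  refine le_antisymm (stature_prod_le_of_stature_le _ _ X Y le_rfl le_rfl) ?_
  rw [stature_eq_rk_top X, stature_eq_rk_top Y]
  exact (le_rk_prod ⊤ ⊤).trans (rk_le_stature _)

end Rectangles

instance instNoetherianSpaceULift {X : Type u} [TopologicalSpace X] [NoetherianSpace X] :
    NoetherianSpace (ULift.{v} X) :=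
  Homeomorph.ulift.isInducing.noetherianSpace

theorem stature_ulift (X : Type u) [TopologicalSpace X] [NoetherianSpace X] :
    stature (ULift.{v} X) = Ordinal.lift.{v} (stature X) := by
  have h := lift_stature_eq_of_homeomorph (Homeomorph.ulift.{v, u} (X := X))
  rwa [Ordinal.lift_id'.{u, v}, Ordinal.lift_umax.{u, v}] at h

end NoetherianStature

theorem mainTheorem1 (X : Type u) (Y : Type v)
    [TopologicalSpace X] [TopologicalSpace.NoetherianSpace X]
    [TopologicalSpace Y] [TopologicalSpace.NoetherianSpace Y] :
    NoetherianStature.stature (X × Y) =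
      NoetherianStature.natProd
        (Ordinal.lift.{v, u} (NoetherianStature.stature X))
        (Ordinal.lift.{u, v} (NoetherianStature.stature Y)) := by
  rw [← NoetherianStature.stature_ulift.{u, v} X, ← NoetherianStature.stature_ulift.{v, u} Y,
    ← NoetherianStature.stature_prod]
  simpa using NoetherianStature.lift_stature_eq_of_homeomorph
    ((Homeomorph.ulift.{v, u} (X := X)).prodCongr (Homeomorph.ulift.{u, v} (X := Y))).symm
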